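/- Let $\phi=(1+\sqrt5)/2$. The game $K^4$ is played on positions $(x,y)\in\mathbb N^2$ (two piles). Positions with $x+y\le 4$ are terminal. From any other position, a player may remove a positive number of tokens from one pile, or the same positive number of tokens from both piles. A player who is unable to move loses. The $\mathcal P$-positions are the positions none of whose options is a $\mathcal P$-position (in particular all terminal positions are $\mathcal P$-positions). Let $F_0=1$, $F_1=2$, $F_{i+2}=F_{i+1}+F_i$, let $\mathrm{val}(d_k\cdots d_0)=\sum_i d_iF_i$, and let $\mathrm{rep}_F(n)$ be the greedy representation of $n$, i.e. the word over $\{0,1\}$ of value $n$ without leading zero and without two consecutive $1$s ($\mathrm{rep}_F(0)$ is empty). A morphism $\mu$ is a $\varphi$-morphism if, for every fixed point $w=w_0w_1\cdots$ of $\mu$ and every $n\ge 0$, $\mu(w_n)=w_{\mathrm{val}(\mathrm{rep}_F(n)0)}$ if $\mathrm{rep}_F(n)$ ends with $1$, and $\mu(w_n)=w_{\mathrm{val}(\mathrm{rep}_F(n)0)}\,w_{\mathrm{val}(\mathrm{rep}_F(n)1)}$ otherwise. A sequence is Fibonacci-automatic if, for every $n\ge0$, its $n$th term is the output of a fixed finite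 deterministic automaton with output (DFAO) fed with $\mathrm{rep}_F(n)$. On the alphabet $\{0,1,\dots,9,a,b,c,d,e,f,g,h\}$ let $$\mu_4:\ 0\mapsto 01,\ 1\mapsto 2,\ 2\mapsto 34,\ 3\mapsto 56,\ 4\mapsto 7,\ 5\mapsto 89,\ 6\mapsto a,\ 7\mapsto bc,\ 8\mapsto dc,$$ $$9\mapsto d,\ a\mapsto ef,\ b\mapsto ef,\ c\mapsto e,\ d\mapsto 7g,\ e\mapsto eh,\ f\mapsto b,\ g\mapsto d,\ h\mapsto b,$$ $$\rho_4:\ 0,3,7,8,9,b,c,d,e,h\mapsto 1,\quad 1,2,a\mapsto 2,\quad 4,5,6,f,g\mapsto 0 .$$ **Theorem.** (i) $\mu_4$ is a $\varphi$-morphism. The words $\mu_4^k(0)$ converge to an infinite fixed point $\mu_4^\omega(0)$ of $\mu_4$. Let $g_4(n)$, $n\ge 0$, be the letter of index $n$ (indices starting from $0$) of $\rho_4(\mu_4^\omega(0))$. Then $g_4$ is Fibonacci-automatic: it is computed by the $18$-state DFAO with initial state $0$, output function $\rho_4$, and transitions $c\xrightarrow{0}x$, $c\xrightarrow{1}y$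 if $\mu_4(c)=xy$, and only $c\xrightarrow{0}x$ if $\mu_4(c)=x$. (ii) For $n\ge0$ let $$a_n=\lfloor (n+2)\phi\rfloor+g_4(n+1),\qquad b_n=\lfloor (n+2)\phi^2\rfloor+g_4(n+1)+3 .$$ For all $a\le b$ in $\mathbb N$, $(a,b)$ is a $\mathcal P$-position of $K^4$ if and only if $a+b\le 4$ or $(a,b)=(a_n,b_n)$ for some $n\ge 0$. Moreover every $(a_n,b_n)$ is non-terminal with $a_n<b_n$, and both $(a_n)_{n\ge0}$ and $(b_n)_{n\ge0}$ are strictly increasing, so that $(a_n,b_n)$ is the $n$th non-terminal $\mathcal P$-position with $a\le b$ (counting from $0$). -/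

import Mathlib

namespace WythoffK

section Game

/-- A Wythoff move on two piles: remove a positive number `k` of tokens from one of the two piles,
or the same positive number `k` of tokens from both. -/
def WythoffMove (p q : ℕ × ℕ) : Prop :=
  ∃ k : ℕ, 0 < k ∧
    ((k ≤ p.1 ∧ q = (p.1 - k, p.2)) ∨
     (k ≤ p.2 ∧ q = (p.1, p.2 - k)) ∨
     (k ≤ p.1 ∧ k ≤ p.2 ∧ q = (p.1 - k, p.2 - k)))

/-- The terminal positions `(x, y)`, `x + y ≤ ℓ`, of the game `K^ℓ`. -/
def IsTerminal (ℓ : ℕ) (p : ℕ × ℕ) : Prop := p.1 + p.2 ≤ ℓ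

/-- `q` is an option of `p` in the game `K^ℓ`: play stops at terminal positions, and at all other
positions the moves are those of Wythoff's game. -/
def IsOption (ℓ : ℕ) (p q : ℕ × ℕ) : Prop := ¬ IsTerminal ℓ p ∧ WythoffMove p q

theorem WythoffMove.lt {p q : ℕ × ℕ} (h : WythoffMove p q) : q.1 + q.2 < p.1 + p.2 := by
  obtain ⟨k, hk, ⟨h1, rfl⟩ | ⟨h1, rfl⟩ | ⟨h1, h2, rfl⟩⟩ := h <;> dsimp only <;> omega

/-- `P`-positions of `K^ℓ` under normal play (a player unable to move loses): the positions
none of whose options is a `P`-position. In particular terminal positions are `P`-positions. -/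
def IsPPosition (ℓ : ℕ) (p : ℕ × ℕ) : Prop :=
  ∀ q : ℕ × ℕ, IsOption ℓ p q → ¬ IsPPosition ℓ q
termination_by p.1 + p.2
decreasing_by
  rename_i h
  exact h.2.lt

end Game

section FibonacciNumeration

/-- The Fibonacci numbers `1, 2, 3, 5, 8, …` used as weights. -/
def F (i : ℕ) : ℕ := Nat.fib (i + 2)

/-- The value `∑ dᵢ Fᵢ` of a word `d_{k} ⋯ d_0`, most significant digit first. -/
def valF : List Bool → ℕ
  | [] => 0
  | d :: u => (if d then F u.length else 0) + valF u

/-- The greedy digits of `n` in the positions `k - 1, …, 0`. -/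
def greedy : ℕ → ℕ → List Bool
  | 0, _ => []
  | k + 1, n => if F k ≤ n then true :: greedy k (n - F k) else false :: greedy k n

/-- The greedy (Fibonacci, or Zeckendorf) representation of `n`, most significant digit first,
without leading zeros; the representation of `0` is the empty word. As `n < F n`, the `n` positions
`n - 1, …, 0` suffice. -/
def repF (n : ℕ) : List Bool := (greedy n n).dropWhile (fun d => !d)

/-- `u` is a word without leading zero and without two consecutive ones, of value `n`. -/
def IsFibRep (u : List Bool) (n : ℕ) : Prop :=
  valF u = n ∧ u.head? ≠ some false ∧ u.IsChain (fun d e => ¬ (d = true ∧ e = true))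

theorem F_pos (i : ℕ) : 0 < F i := Nat.fib_pos.2 (by omega)
theorem F_succ (i : ℕ) : F (i + 2) = F i + F (i + 1) := Nat.fib_add_two
theorem lt_F (n : ℕ) : n < F n := by
  induction n using Nat.strong_induction_on with
  | _ n ih =>
    match n with
    | 0 => decide
    | 1 => decide
    | n + 2 =>
      have h1 := ih (n + 1) (by omega)
      have h2 := F_pos n
      rw [F_succ]; omega

theorem length_greedy (k n : ℕ) : (greedy k n).length = k := by
  induction k generalizing n with
  | zero => rfl
  | succ k ih => simp only [greedy]; split <;> simp [ih]

theorem greedy_spec (k n : ℕ) (h : n < F k) :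
    valF (greedy k n) = n ∧ (greedy k n).IsChain (fun d e => ¬ (d = true ∧ e = true)) := by
  induction k using Nat.strong_induction_on generalizing n with
  | _ k ih =>
    match k with
    | 0 =>
      have h0 : F 0 = 1 := rfl
      simp [greedy, valF]; omega
    | 1 =>
      have h0 : F 0 = 1 := rfl
      have h1 : F 1 = 2 := rfl
      by_cases hn : 1 ≤ n
      · simp [greedy, valF, h0, hn]; omega
      · simp [greedy, valF, h0, hn]; omega
    | k + 2 =>
      rw [F_succ] at h
      by_cases hn : F (k + 1) ≤ n
      · have hlt : n - F (k + 1) < F k := by omega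
        have hle : ¬ F k ≤ n - F (k + 1) := by omega
        obtain ⟨h1, h2⟩ := ih k (by omega) _ hlt
        obtain ⟨h3, h4⟩ := ih (k + 1) (by omega) (n - F (k + 1))
          (lt_of_lt_of_le hlt (Nat.fib_mono (by omega)))
        rw [greedy, if_pos hn]
        refine ⟨?_, ?_⟩
        · simp only [valF, length_greedy, h3, if_true]; omega
        · simp only [greedy, if_neg hle] at h4 ⊢
          rw [List.isChain_cons]
          exact ⟨by simp, h4⟩
      · obtain ⟨h3, h4⟩ := ih (k + 1) (by omega) n (by omega)
        rw [greedy, if_neg hn]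
        refine ⟨by simp [valF, h3], ?_⟩
        rw [List.isChain_cons]
        exact ⟨by simp, h4⟩

theorem valF_dropWhile (u : List Bool) : valF (u.dropWhile (fun d => !d)) = valF u := by
  induction u with
  | nil => rfl
  | cons d u ih => cases d <;> simp [valF, ih]

/-- `repF n` is a representation of `n` of the required form. -/
theorem isFibRep_repF (n : ℕ) : IsFibRep (repF n) n := by
  obtain ⟨h1, h2⟩ := greedy_spec n n (lt_F n)
  refine ⟨by rw [repF, valF_dropWhile, h1], ?_, h2.suffix (List.dropWhile_suffix _)⟩
  intro h
  have := List.head?_dropWhile_not (fun d => !d) (greedy n n)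
  rw [repF] at h
  rw [h] at this
  simp at this

theorem valF_lt (u : List Bool) (h : u.IsChain (fun d e => ¬ (d = true ∧ e = true))) :
    valF u < F u.length := by
  induction hk : u.length using Nat.strong_induction_on generalizing u with
  | _ k ih =>
    match u with
    | [] => subst hk; decide
    | [d] => subst hk; cases d <;> decide
    | false :: u =>
      have := ih u.length (by simp at hk; omega) u (List.isChain_cons.1 h).2 rfl
      subst hk
      have h2 : F u.length ≤ F (u.length + 1) := Nat.fib_mono (by omega)
      simp [valF]; omega
    | true :: true :: u => simp at h
    | true :: false :: u =>
      have := ih u.length (by simp at hk; omega) u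
        (List.isChain_cons.1 (List.isChain_cons.1 h).2).2 rfl
      subst hk
      simp [valF, F_succ]; omega

/-- `repF n` is the only one. -/
theorem IsFibRep.eq_repF {u : List Bool} {n : ℕ} (h : IsFibRep u n) : u = repF n := by
  have key : ∀ u : List Bool, u.IsChain (fun d e => ¬ (d = true ∧ e = true)) →
      greedy u.length (valF u) = u := by
    intro u hu
    induction u with
    | nil => rfl
    | cons d u ih =>
      have hu' := (List.isChain_cons.1 hu).2
      have := valF_lt u hu'
      cases d
      · simp [valF, greedy, ih hu', Nat.not_le.2 this]
      · simp [valF, greedy, ih hu']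
  have pad : ∀ k j m, m < F k →
      (greedy (k + j) m).dropWhile (fun d => !d) = (greedy k m).dropWhile (fun d => !d) := by
    intro k j m hm
    induction j with
    | zero => rfl
    | succ j ih =>
      have : m < F (k + j) := lt_of_lt_of_le hm (Nat.fib_mono (by omega))
      rw [← add_assoc, greedy, if_neg (by omega)]
      simpa [List.dropWhile_cons] using ih
  obtain ⟨rfl, h2, h3⟩ := h
  have hd : u.dropWhile (fun d => !d) = u := by
    match u with
    | [] => rfl
    | true :: u => simp
    | false :: u => simp at h2
  have e1 := pad u.length (valF u) (valF u) (valF_lt u h3)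
  have e2 := pad (valF u) u.length (valF u) (lt_F _)
  rw [add_comm, e2, key u h3, hd] at e1
  exact e1.symm
end FibonacciNumeration

section Words

variable {A : Type*}

/-- The morphism of free monoids that extends `μ : A → A*`. -/
def applyMorphism (μ : A → List A) (u : List A) : List A := u.flatMap μ

/-- The finite word `u` is a prefix of the infinite word `w`. -/
def IsPrefixOf (u : List A) (w : ℕ → A) : Prop := u = (List.range u.length).map w

/-- The infinite word `w` is a fixed point of `μ`: the concatenation `μ(w 0) μ(w 1) ⋯` is infinite
and equal to `w`. -/
def IsFixedPoint (μ : A → List A) (w : ℕ → A) : Prop :=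
  (∀ k, IsPrefixOf (applyMorphism μ ((List.range k).map w)) w) ∧
  (∀ N, ∃ k, N ≤ (applyMorphism μ ((List.range k).map w)).length)

/-- The word `μ^ω(a)`, for a non-erasing `μ` such that `μ(a)` begins with `a` and has length at
least two: then `μ^n(a)` has more than `n` letters and is a prefix of `μ^(n+1)(a)`, so the letter
of index `n` of the limit can be read off in `μ^n(a)`. -/
def omegaPower (μ : A → List A) (a : A) (n : ℕ) : A :=
  (((applyMorphism μ)^[n]) [a]).getD n a

/-- `w` is the limit of the words `μ^k(a)`: they are prefixes of `w`, of unbounded length. -/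
def IsOmegaLimit (μ : A → List A) (a : A) (w : ℕ → A) : Prop :=
  (∀ k, IsPrefixOf (((applyMorphism μ)^[k]) [a]) w) ∧
  (∀ N, ∃ k, N ≤ (((applyMorphism μ)^[k]) [a]).length)

/-- `φ`-morphisms: for every fixed point `w` and every `n`, the image `μ(w n)` is the one-letter word
with the letter of `w` at position `val(rep(n)0)` if `rep(n)` ends with `1`; otherwise it is the
two-letter word with the letters at the positions `val(rep(n)0)` and `val(rep(n)1)`. -/
def IsPhiMorphism (μ : A → List A) : Prop :=
  ∀ w : ℕ → A, IsFixedPoint μ w → ∀ n : ℕ,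
    μ (w n) = if (repF n).getLast? = some true
      then [w (valF (repF n ++ [false]))]
      else [w (valF (repF n ++ [false])), w (valF (repF n ++ [true]))]

/-- Deterministic automata with output over the input alphabet `{0, 1}`, with a partial transition
function. -/
structure DFAO (Q B : Type*) where
  init : Q
  trans : Q → Bool → Option Q
  out : Q → B

/-- The output of the automaton on the word `u`, if `u` can be read. -/
def DFAO.output {Q B : Type*} (M : DFAO Q B) (u : List Bool) : Option B :=
  (u.foldlM M.trans M.init).map M.out

/-- `f n` is the output of the automaton fed with the Fibonacci representation of `n`. -/
def DFAO.Computes {Q B : Type*} (M : DFAO Q B) (f : ℕ → B) : Prop :=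
  ∀ n, M.output (repF n) = some (f n)

/-- Fibonacci-automatic sequences. -/
def IsFibonacciAutomatic {B : Type*} (f : ℕ → B) : Prop :=
  ∃ (s : ℕ) (M : DFAO (Fin s) B), M.Computes f

/-- The automaton of a morphism and a coding: its states are the letters, and there is a transition
from `c` with label `i` to the letter of index `i` of `μ(c)`, if there is one. -/
def morphismDFAO {B : Type*} (μ : A → List A) (ρ : A → B) (a : A) : DFAO A B where
  init := a
  trans c d := (μ c)[d.toNat]?
  out := ρ

end Words

section K4

/-- The morphism `μ₄`; the letters `a, b, …, h` are `10, 11, …, 17`. -/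
def mu4 : Fin 18 → List (Fin 18) :=
  ![[0, 1], [2], [3, 4], [5, 6], [7], [8, 9], [10], [11, 12], [13, 12],
    [13], [14, 15], [14, 15], [14], [7, 16], [14, 17], [11], [13], [11]]

/-- The coding `ρ₄`. -/
def rho4 : Fin 18 → ℕ :=
  ![1, 2, 2, 1, 0, 0, 0, 1, 1, 1, 2, 1, 1, 1, 1, 0, 0, 1]

/-- The letter of index `n` (starting from `0`) of `ρ₄(μ₄^ω(0))`. -/
def g4 (n : ℕ) : ℕ := rho4 (omegaPower mu4 0 n)

/-- `a_n = ⌊(n+2)φ⌋ + g₄(n+1)`. -/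
noncomputable def posA (n : ℕ) : ℕ :=
  ⌊((n : ℝ) + 2) * Real.goldenRatio⌋₊ + g4 (n + 1)

/-- `b_n = ⌊(n+2)φ²⌋ + g₄(n+1) + 3`. -/
noncomputable def posB (n : ℕ) : ℕ :=
  ⌊((n : ℝ) + 2) * Real.goldenRatio ^ 2⌋₊ + g4 (n + 1) + 3

end K4

end WythoffK

/-! By `isPPosition_four_iff` it suffices that `posA` and `posB` increase, that `posB n - posA n = n
+ 5`, and that their values partition the integers from 5 on: the terminal positions absorb small
piles and differences at most 4, and Wythoff's argument handles the rest.

Write `s k` for the length of `μ₄(w 0 ⋯ w (k-1))`, `w` being a fixed point. Forgetting everything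
about a letter but the length of its image turns `μ₄` into the Fibonacci morphism `2 ↦ 21`, `1 ↦ 2`.
Hence `s (s k) = s k + k`, which gives both `⌊(k+1)φ⌋ = s k + 1` (`floor_mul_goldenRatio`) and the
fact that `s` appends a zero to Fibonacci representations (`shiftLen_valF`); the latter yields the
`φ`-morphism and the automaton.

So `posA` and `posB` become `seqA` and `seqB`, written in terms of `s` and letters of `w` only.
Their steps and relative position depend on boundedly many consecutive letters, and are checked on
the finite list `factors4`. Each `seqB k` falls in a gap of `seqA` (`exists_seqA_gap`), and since
`seqB` has steps 2 or 3, every other integer beyond the first values is adjacent to such a gap,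
hence in `seqA`. -/

namespace WythoffK

/-! ### Kernels and Wythoff's argument for `K⁴` -/

section Game

theorem isPPosition_iff {ℓ : ℕ} {p : ℕ × ℕ} :
    IsPPosition ℓ p ↔ ∀ q : ℕ × ℕ, IsOption ℓ p q → ¬ IsPPosition ℓ q := by
  rw [IsPPosition]

/-- A kernel of the game graph is the set of `P`-positions. -/
theorem isPPosition_iff_of_kernel {ℓ : ℕ} {S : ℕ × ℕ → Prop}
    (stable : ∀ p q, S p → IsOption ℓ p q → ¬ S q)
    (absorbing : ∀ p, ¬ S p → ∃ q, IsOption ℓ p q ∧ S q) (p : ℕ × ℕ) :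
    IsPPosition ℓ p ↔ S p := by
  induction hn : p.1 + p.2 using Nat.strong_induction_on generalizing p with
  | _ n ih =>
    subst hn
    have ih' : ∀ q, IsOption ℓ p q → (IsPPosition ℓ q ↔ S q) := fun q hq => ih _ hq.2.lt q rfl
    rw [isPPosition_iff]
    constructor
    · intro h
      by_contra hp
      obtain ⟨q, hq, hS⟩ := absorbing p hp
      exact h q hq ((ih' q hq).2 hS)
    · intro hp q hq
      rw [ih' q hq]
      exact stable p q hp hq

/-- The terminal positions of `K⁴` and the pairs `(A n, B n)`, in either order. -/
def Candidate (A B : ℕ → ℕ) (p : ℕ × ℕ) : Prop :=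
  IsTerminal 4 p ∨ ∃ n, p = (A n, B n) ∨ p = (B n, A n)

variable {A B : ℕ → ℕ}

theorem Candidate.swap {x y : ℕ} (h : Candidate A B (x, y)) : Candidate A B (y, x) := by
  rcases h with h | ⟨n, h | h⟩
  · left; simp only [IsTerminal] at h ⊢; omega
  · right; refine ⟨n, Or.inr ?_⟩; simp_all
  · right; refine ⟨n, Or.inl ?_⟩; simp_all

theorem IsOption.swap {x y x' y' : ℕ} (h : IsOption 4 (x, y) (x', y')) :
    IsOption 4 (y, x) (y', x') := by
  obtain ⟨h, k, hk, h'⟩ := h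
  refine ⟨by simp only [IsTerminal] at h ⊢; omega, k, hk, ?_⟩
  simp only [Prod.mk.injEq] at h' ⊢
  omega

/-- A one-pile move keeps a coordinate and a diagonal move keeps the difference `n + 5`; each of
these determines the pair. Terminal positions are out of reach because the kept coordinate or
difference is at least 5. -/
theorem candidate_stable (hA : StrictMono A) (hB : ∀ n, B n = A n + n + 5) (h5 : 5 ≤ A 0)
    (hdis : ∀ n m, A n ≠ B m) (p q : ℕ × ℕ) (hp : Candidate A B p) (ho : IsOption 4 p q) :
    ¬ Candidate A B q := by
  have hBm : StrictMono B := fun i j hij => by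
    have := hA hij
    rw [hB, hB]; omega
  have key : ∀ n x y, IsOption 4 (A n, B n) (x, y) → ¬ Candidate A B (x, y) := by
    rintro n x y ⟨-, k, hk, h⟩ hq
    have hn := hA.monotone (Nat.zero_le n)
    have hBn := hB n
    simp only [Prod.mk.injEq] at h
    rcases hq with hq | ⟨m, hq | hq⟩
    · simp only [IsTerminal] at hq
      omega
    · simp only [Prod.mk.injEq] at hq
      have hBm' := hB m
      have : n = m := by
        rcases h with h | h | h
        · exact hBm.injective (by omega)
        · exact hA.injective (by omega)
        · omega
      subst this
      omega
    · simp only [Prod.mk.injEq] at hq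
      have hBm' := hB m
      have h1 := hdis n m
      have h2 := hdis m n
      omega
  obtain ⟨x, y⟩ := q
  rcases hp with hp | ⟨n, rfl | rfl⟩
  · exact absurd hp ho.1
  · exact key n x y ho
  · exact fun hq => key n y x ho.swap hq.swap

/-- Take `x ≤ y`. If `x ≤ 4`, empty the pile `y`. If `x = B n`, or `x = A n` with `y > B n`, reduce
`y` to the partner of `x`. If `x = A n` and `y < B n`, move diagonally, choosing the target by the
difference `y - x`. -/
theorem candidate_absorbing (hA : StrictMono A) (hB : ∀ n, B n = A n + n + 5)
    (hcov : ∀ x, 5 ≤ x → ∃ n, x = A n ∨ x = B n) (p : ℕ × ℕ) (hp : ¬ Candidate A B p) :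
    ∃ q, IsOption 4 p q ∧ Candidate A B q := by
  have key : ∀ x y, x ≤ y → ¬ Candidate A B (x, y) →
      ∃ x' y', IsOption 4 (x, y) (x', y') ∧ Candidate A B (x', y') := by
    intro x y hxy hp
    have hT : ¬ IsTerminal 4 (x, y) := fun h => hp (Or.inl h)
    have hT' : 4 < x + y := by simpa [IsTerminal] using hT
    by_cases hx : x ≤ 4
    · refine ⟨x, 0, ⟨hT, y, by omega, Or.inr (Or.inl ⟨le_rfl, by simp⟩)⟩, Or.inl ?_⟩
      simpa [IsTerminal] using hx
    obtain ⟨n, rfl | rfl⟩ := hcov x (by omega)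
    · have hBn := hB n
      rcases lt_trichotomy y (B n) with hy | hy | hy
      · by_cases hd : y - A n ≤ 4
        · refine ⟨0, y - A n, ⟨hT, A n, by omega, Or.inr (Or.inr ⟨le_rfl, hxy, by simp⟩)⟩,
            Or.inl ?_⟩
          simpa [IsTerminal] using hd
        -- The pair with this difference has index `m < n`, since `y < B n`; so it lies below on the
        -- same diagonal.
        · obtain ⟨m, hm⟩ : ∃ m, y - A n = m + 5 := ⟨y - A n - 5, by omega⟩
          have hmn : A m < A n := hA (by omega)
          have hBm := hB m
          refine ⟨A m, B m, ⟨hT, A n - A m, by omega, Or.inr (Or.inr ⟨?_, ?_, ?_⟩)⟩,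
            Or.inr ⟨m, Or.inl rfl⟩⟩
          · simp
          · simp only; omega
          · simp only [Prod.mk.injEq]; omega
      · exact absurd (Or.inr ⟨n, Or.inl (by rw [hy])⟩) hp
      · refine ⟨A n, B n, ⟨hT, y - B n, by omega, Or.inr (Or.inl ⟨?_, ?_⟩)⟩,
          Or.inr ⟨n, Or.inl rfl⟩⟩
        · simp
        · exact Prod.ext rfl (by simp only; omega)
    · have hBn := hB n
      refine ⟨B n, A n, ⟨hT, y - A n, by omega, Or.inr (Or.inl ⟨?_, ?_⟩)⟩,
        Or.inr ⟨n, Or.inr rfl⟩⟩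
      · simp
      · exact Prod.ext rfl (by simp only; omega)
  obtain ⟨x, y⟩ := p
  rcases le_total x y with hxy | hxy
  · obtain ⟨x', y', h1, h2⟩ := key x y hxy hp
    exact ⟨(x', y'), h1, h2⟩
  · obtain ⟨x', y', h1, h2⟩ := key y x hxy (fun h => hp h.swap)
    exact ⟨(y', x'), h1.swap, h2.swap⟩

/-- Two complementary sequences of `{5, 6, …}` with `B n - A n = n + 5` list the nonterminal
`P`-positions of `K⁴`. -/
theorem isPPosition_four_iff (hA : StrictMono A) (hB : ∀ n, B n = A n + n + 5) (h5 : 5 ≤ A 0)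
    (hdis : ∀ n m, A n ≠ B m) (hcov : ∀ x, 5 ≤ x → ∃ n, x = A n ∨ x = B n)
    {a b : ℕ} (hab : a ≤ b) :
    IsPPosition 4 (a, b) ↔ IsTerminal 4 (a, b) ∨ ∃ n, a = A n ∧ b = B n := by
  rw [isPPosition_iff_of_kernel (candidate_stable hA hB h5 hdis) (candidate_absorbing hA hB hcov)]
  refine or_congr Iff.rfl (exists_congr fun n => ?_)
  have := hB n
  simp only [Prod.mk.injEq]
  omega

end Game

/-! ### Factors of infinite words and lengths of images of prefixes -/

section Words

variable {A : Type*} {μ : A → List A} {w : ℕ → A}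

/-- The factor of length `L` of the infinite word `w` that starts at index `k`. -/
def factor (w : ℕ → A) (k L : ℕ) : List A := (List.range' k L).map w

@[simp] theorem length_factor (w : ℕ → A) (k L : ℕ) : (factor w k L).length = L := by
  simp [factor]

theorem factor_add (w : ℕ → A) (k L M : ℕ) :
    factor w k (L + M) = factor w k L ++ factor w (k + L) M := by
  simp [factor, ← List.map_append]

@[simp] theorem factor_one (w : ℕ → A) (k : ℕ) : factor w k 1 = [w k] := rfl

theorem getElem?_factor (w : ℕ → A) (k : ℕ) {L i : ℕ} (hi : i < L) :
    (factor w k L)[i]? = some (w (k + i)) := by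
  simp [factor, hi]

theorem drop_take_factor (w : ℕ → A) (k : ℕ) {L i M : ℕ} (h : i + M ≤ L) :
    ((factor w k L).drop i).take M = factor w (k + i) M := by
  obtain ⟨N, rfl⟩ := Nat.exists_eq_add_of_le h
  rw [factor_add, factor_add, List.append_assoc, List.drop_left' (by simp),
    List.take_left' (by simp)]

theorem take_factor (w : ℕ → A) (k : ℕ) {L M : ℕ} (h : M ≤ L) :
    (factor w k L).take M = factor w k M := by
  simpa using drop_take_factor w k (i := 0) (by simpa using h)

theorem isPrefixOf_iff {u : List A} : IsPrefixOf u w ↔ u = factor w 0 u.length := by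
  simp [IsPrefixOf, factor, List.range_eq_range']

/-- The position at which `μ (w k)` starts in `μ (w 0) μ (w 1) ⋯`. -/
def shiftLen (μ : A → List A) (w : ℕ → A) (k : ℕ) : ℕ := ((factor w 0 k).flatMap μ).length

@[simp] theorem shiftLen_zero : shiftLen μ w 0 = 0 := rfl

theorem shiftLen_add (k L : ℕ) :
    shiftLen μ w (k + L) = shiftLen μ w k + ((factor w k L).flatMap μ).length := by
  simp [shiftLen, factor_add]

theorem shiftLen_succ (k : ℕ) : shiftLen μ w (k + 1) = shiftLen μ w k + (μ (w k)).length := by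
  simp [shiftLen_add]

theorem IsFixedPoint.flatMap_factor (h : IsFixedPoint μ w) (k L : ℕ) :
    (factor w k L).flatMap μ =
      factor w (shiftLen μ w k) ((factor w k L).flatMap μ).length := by
  have h0 : ∀ k, (factor w 0 k).flatMap μ = factor w 0 (shiftLen μ w k) := fun k => by
    have := h.1 k
    rw [isPrefixOf_iff] at this
    simpa [applyMorphism, shiftLen, factor, List.range_eq_range'] using this
  have h1 := h0 (k + L)
  rw [shiftLen_add, factor_add, factor_add, List.flatMap_append, h0 k, zero_add, zero_add] at h1
  exact List.append_cancel_left h1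

theorem IsFixedPoint.apply_eq (h : IsFixedPoint μ w) (k : ℕ) :
    μ (w k) = factor w (shiftLen μ w k) (μ (w k)).length := by
  simpa using h.flatMap_factor k 1

theorem IsFixedPoint.shiftLen_shiftLen (h : IsFixedPoint μ w) (k : ℕ) :
    shiftLen μ w (shiftLen μ w k) = (((factor w 0 k).flatMap μ).flatMap μ).length := by
  rw [h.flatMap_factor 0 k]; rfl

theorem exists_eq_shiftLen_add (hne : ∀ a, μ a ≠ []) (k : ℕ) :
    ∃ j i, i < (μ (w j)).length ∧ k = shiftLen μ w j + i := by
  have hpos : ∀ a, 0 < (μ a).length := fun a => List.length_pos_of_ne_nil (hne a)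
  induction k with
  | zero => exact ⟨0, 0, hpos _, rfl⟩
  | succ k ih =>
    obtain ⟨j, i, hi, rfl⟩ := ih
    by_cases h : i + 1 < (μ (w j)).length
    · exact ⟨j, i + 1, h, by omega⟩
    · exact ⟨j + 1, 0, hpos _, by rw [shiftLen_succ]; omega⟩

end Words

end WythoffK
namespace WythoffK

/-! ### The limit of the iterates of a morphism -/

section OmegaPower

variable {A : Type*} {μ : A → List A} {a : A} {t : List A}

theorem iterate_isPrefix_succ (ha : μ a = a :: t) (k : ℕ) :
    (applyMorphism μ)^[k] [a] <+: (applyMorphism μ)^[k + 1] [a] := by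
  induction k with
  | zero => exact ⟨t, by simp [applyMorphism, ha]⟩
  | succ k ih =>
    obtain ⟨v, hv⟩ := ih
    rw [Function.iterate_succ_apply', Function.iterate_succ_apply' _ (k + 1), ← hv]
    exact ⟨applyMorphism μ v, by simp [applyMorphism]⟩

theorem iterate_isPrefix (ha : μ a = a :: t) {k l : ℕ} (h : k ≤ l) :
    (applyMorphism μ)^[k] [a] <+: (applyMorphism μ)^[l] [a] := by
  induction l, h using Nat.le_induction with
  | base => exact List.prefix_rfl
  | succ l _ ih => exact ih.trans (iterate_isPrefix_succ ha l)

theorem length_le_length_applyMorphism (hne : ∀ a, μ a ≠ []) (u : List A) :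
    u.length ≤ (applyMorphism μ u).length := by
  induction u with
  | nil => simp
  | cons b u ih =>
    have := List.length_pos_of_ne_nil (hne b)
    simp only [applyMorphism, List.flatMap_cons, List.length_append, List.length_cons] at ih ⊢
    omega

theorem lt_length_iterate (ha : μ a = a :: t) (ht : t ≠ []) (hne : ∀ a, μ a ≠ []) (k : ℕ) :
    k < ((applyMorphism μ)^[k] [a]).length := by
  induction k with
  | zero => simp
  | succ k ih =>
    obtain ⟨v, hv⟩ := iterate_isPrefix ha (Nat.zero_le k)
    have h1 := length_le_length_applyMorphism hne v
    have h2 := List.length_pos_of_ne_nil ht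
    rw [Function.iterate_succ_apply']
    rw [← hv] at ih ⊢
    simp only [applyMorphism, Function.iterate_zero, id, List.flatMap_append, List.flatMap_cons,
      List.flatMap_nil, ha, List.length_append, List.length_cons, List.length_nil] at h1 ih ⊢
    omega

theorem isPrefixOf_omegaPower (ha : μ a = a :: t) (ht : t ≠ []) (hne : ∀ a, μ a ≠ []) (k : ℕ) :
    IsPrefixOf ((applyMorphism μ)^[k] [a]) (omegaPower μ a) := by
  refine List.ext_getElem (by simp) fun n h1 h2 => ?_
  have h3 := lt_length_iterate ha ht hne n
  simp only [List.getElem_map, List.getElem_range, omegaPower, List.getD_eq_getElem _ _ h3]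
  rcases le_total k n with h | h
  · exact (iterate_isPrefix ha h).getElem h1
  · exact ((iterate_isPrefix ha h).getElem h3).symm

theorem isOmegaLimit_omegaPower (ha : μ a = a :: t) (ht : t ≠ []) (hne : ∀ a, μ a ≠ []) :
    IsOmegaLimit μ a (omegaPower μ a) :=
  ⟨isPrefixOf_omegaPower ha ht hne, fun N => ⟨N, (lt_length_iterate ha ht hne N).le⟩⟩

theorem IsPrefixOf.of_isPrefix {u v : List A} {w : ℕ → A} (h : IsPrefixOf v w) (huv : u <+: v) :
    IsPrefixOf u w := by
  rw [isPrefixOf_iff] at h ⊢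
  have := List.prefix_iff_eq_take.1 huv
  rw [h, take_factor w 0 huv.length_le] at this
  exact this

/-- The first `k` letters of the limit form a prefix of `μ^k(a)`, so their image is a prefix of
`μ^(k+1)(a)`, which is again a prefix of the limit. -/
theorem isFixedPoint_omegaPower (ha : μ a = a :: t) (ht : t ≠ []) (hne : ∀ a, μ a ≠ []) :
    IsFixedPoint μ (omegaPower μ a) := by
  refine ⟨fun k => ?_, fun N => ⟨N, ?_⟩⟩
  · refine (isPrefixOf_omegaPower ha ht hne (k + 1)).of_isPrefix ?_
    have h1 := isPrefixOf_omegaPower ha ht hne k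
    have h2 := (lt_length_iterate ha ht hne k).le
    rw [isPrefixOf_iff] at h1
    have h3 := take_factor (omegaPower μ a) 0 h2
    rw [← h1] at h3
    rw [Function.iterate_succ_apply', List.range_eq_range']
    change applyMorphism μ (factor (omegaPower μ a) 0 k) <+: _
    rw [← h3]
    generalize (applyMorphism μ)^[k] [a] = u
    refine ⟨applyMorphism μ (u.drop k), ?_⟩
    rw [applyMorphism, applyMorphism, applyMorphism, ← List.flatMap_append, List.take_append_drop]
  · simpa using length_le_length_applyMorphism hne ((List.range N).map (omegaPower μ a))

end OmegaPower

/-! ### Fibonacci structure of `μ₄` and the golden ratio -/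

section Shift

theorem mu4_ne_nil : ∀ c, mu4 c ≠ [] := by decide

theorem length_mu4 : ∀ c, (mu4 c).length = 1 ∨ (mu4 c).length = 2 := by decide

theorem length_mu4_first : ∀ c d, (mu4 c)[0]? = some d → (mu4 d).length = 2 := by decide

theorem length_mu4_second : ∀ c d, (mu4 c)[1]? = some d → (mu4 d).length = 1 := by decide

/-- The first letter of an image has an image of length 2, the second one of length 1: both sides
are 3 or both are 2. -/
theorem length_mu4_mu4 : ∀ c, ((mu4 c).flatMap mu4).length = (mu4 c).length + 1 := by decide

variable {w : ℕ → Fin 18}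

theorem mu4_getElem? (h : IsFixedPoint mu4 w) {k i : ℕ} (hi : i < (mu4 (w k)).length) :
    (mu4 (w k))[i]? = some (w (shiftLen mu4 w k + i)) := by
  rw [h.apply_eq k, getElem?_factor _ _ hi]

theorem shiftLen_mu4_shiftLen (h : IsFixedPoint mu4 w) (k : ℕ) :
    shiftLen mu4 w (shiftLen mu4 w k) = shiftLen mu4 w k + k := by
  have key : ∀ u : List (Fin 18), ((u.flatMap mu4).flatMap mu4).length =
      (u.flatMap mu4).length + u.length := by
    intro u
    induction u with
    | nil => rfl
    | cons c u ih =>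
      have := length_mu4_mu4 c
      simp only [List.flatMap_cons, List.flatMap_append, List.length_append, List.length_cons]
      omega
  rw [h.shiftLen_shiftLen, key, length_factor, shiftLen]

theorem length_mu4_shiftLen (h : IsFixedPoint mu4 w) (k : ℕ) :
    (mu4 (w (shiftLen mu4 w k))).length = 2 :=
  length_mu4_first _ _ (mu4_getElem? h (i := 0) (List.length_pos_of_ne_nil (mu4_ne_nil _)))

theorem length_mu4_shiftLen_add_one (h : IsFixedPoint mu4 w) {k : ℕ}
    (hk : (mu4 (w k)).length = 2) : (mu4 (w (shiftLen mu4 w k + 1))).length = 1 :=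
  length_mu4_second _ _ (mu4_getElem? h (i := 1) (by omega))

theorem length_mu4_zero (h : IsFixedPoint mu4 w) : (mu4 (w 0)).length = 2 :=
  length_mu4_shiftLen h 0

theorem lt_shiftLen_mu4 (h : IsFixedPoint mu4 w) {k : ℕ} (hk : 0 < k) :
    k < shiftLen mu4 w k := by
  induction k, hk using Nat.le_induction with
  | base => rw [shiftLen_succ, length_mu4_zero h]; simp
  | succ k _ ih =>
    have := length_mu4 (w k)
    rw [shiftLen_succ]; omega

/-- Every index is `shiftLen j` or `shiftLen j + 1` for an earlier `j`. -/
theorem exists_lt_eq_shiftLen_add (h : IsFixedPoint mu4 w) {k : ℕ} (hk : 0 < k) :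
    ∃ j i, j < k ∧ i < (mu4 (w j)).length ∧ k = shiftLen mu4 w j + i := by
  obtain ⟨j, i, hi, rfl⟩ := exists_eq_shiftLen_add (w := w) mu4_ne_nil k
  refine ⟨j, i, ?_, hi, rfl⟩
  rcases Nat.eq_zero_or_pos j with rfl | hj
  · exact hk
  · have := lt_shiftLen_mu4 h hj
    omega

open Real in
-- With `k = s j + i` and `s (s j) = s j + j`, the bounds for `k` follow from those for `j`
-- multiplied by `φ - 1 = 1/φ`, together with `1 < φ < 2`.
theorem shiftLen_mu4_bounds (h : IsFixedPoint mu4 w) (k : ℕ) :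
    (shiftLen mu4 w k : ℝ) + 1 < (k + 1) * goldenRatio ∧
      ((k : ℝ) + 1) * goldenRatio < shiftLen mu4 w k + 2 := by
  have h1 := one_lt_goldenRatio
  have h2 := goldenRatio_lt_two
  have h3 := goldenRatio_sq
  induction k using Nat.strong_induction_on with
  | _ k ih =>
    rcases Nat.eq_zero_or_pos k with rfl | hk
    · simp only [shiftLen_zero, Nat.cast_zero]
      constructor <;> linarith
    obtain ⟨j, i, hj, hi, rfl⟩ := exists_lt_eq_shiftLen_add h hk
    obtain ⟨h4, h5⟩ := ih j hj
    have h6 := shiftLen_mu4_shiftLen h j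
    have h7 := length_mu4 (w j)
    have h8 : (goldenRatio - 1) * goldenRatio = 1 := by linarith
    have h9 := mul_lt_mul_of_pos_left h4 (sub_pos.2 h1)
    have h10 := mul_lt_mul_of_pos_left h5 (sub_pos.2 h1)
    have h11 : (goldenRatio - 1) * (((j : ℝ) + 1) * goldenRatio) = j + 1 := by
      linear_combination ((j : ℝ) + 1) * h8
    rw [h11] at h9 h10
    obtain rfl | rfl : i = 0 ∨ i = 1 := by omega
    · rw [add_zero, h6]
      push_cast
      constructor <;> linarith
    · rw [shiftLen_succ, length_mu4_shiftLen h, h6]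
      push_cast
      constructor <;> linarith

theorem floor_mul_goldenRatio (h : IsFixedPoint mu4 w) (k : ℕ) :
    ⌊((k : ℝ) + 1) * Real.goldenRatio⌋₊ = shiftLen mu4 w k + 1 := by
  obtain ⟨h1, h2⟩ := shiftLen_mu4_bounds h k
  rw [Nat.floor_eq_iff (by positivity)]
  push_cast
  constructor <;> linarith

end Shift

/-! ### Fibonacci representations, the `φ`-morphism and the automaton -/

section Representation

theorem valF_append_singleton (u : List Bool) (d : Bool) :
    valF (u ++ [d]) = valF (u ++ [false]) + d.toNat := by
  induction u with
  | nil => cases d <;> rfl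
  | cons e u ih =>
    simp only [List.cons_append, valF, ih, List.length_append, List.length_singleton]
    omega

/-- The Fibonacci recurrence digit by digit; it mirrors `s (s k) = s k + k`. -/
theorem valF_append_false_false (u : List Bool) :
    valF (u ++ [false] ++ [false]) = valF (u ++ [false]) + valF u := by
  induction u with
  | nil => rfl
  | cons e u ih =>
    simp only [List.cons_append, valF, ih, List.length_append, List.length_singleton]
    cases e
    · simp
    · simp only [if_true, F_succ]
      omega

theorem valF_append_true_false (u : List Bool) :
    valF (u ++ [true] ++ [false]) = valF (u ++ [false] ++ [false]) + 2 := by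
  induction u with
  | nil => rfl
  | cons e u ih =>
    simp only [List.cons_append, valF, ih, List.length_append, List.length_singleton]
    omega

/-- Words without two consecutive ones. -/
def NoConsecutiveOnes (u : List Bool) : Prop := u.IsChain (fun d e => ¬ (d = true ∧ e = true))

theorem noConsecutiveOnes_append_singleton {u : List Bool} {d : Bool} :
    NoConsecutiveOnes (u ++ [d]) ↔
      NoConsecutiveOnes u ∧ (d = true → u.getLast? ≠ some true) := by
  unfold NoConsecutiveOnes
  rw [List.isChain_append]
  cases u.getLast? <;> cases d <;> simp

variable {w : ℕ → Fin 18}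

/-- Reading a word `u` without two consecutive ones: `shiftLen` appends a zero to `u`, and the letter
at the position `valF u` has a one-letter image iff `u` ends with a one. -/
theorem shiftLen_valF (h : IsFixedPoint mu4 w) {u : List Bool} (hu : NoConsecutiveOnes u) :
    shiftLen mu4 w (valF u) = valF (u ++ [false]) ∧
      (mu4 (w (valF u))).length = if u.getLast? = some true then 1 else 2 := by
  induction u using List.reverseRecOn with
  | nil => exact ⟨rfl, by simpa [valF] using length_mu4_zero h⟩
  | append_singleton v d ih =>
    obtain ⟨hv, hd⟩ := noConsecutiveOnes_append_singleton.1 hu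
    obtain ⟨h1, h2⟩ := ih hv
    have h3 := shiftLen_mu4_shiftLen h (valF v)
    have h4 := length_mu4_shiftLen h (valF v)
    have h5 := valF_append_false_false v
    cases d
    · rw [← h1]
      refine ⟨?_, by simpa using h4⟩
      omega
    · rw [if_neg (hd rfl)] at h2
      have h6 := length_mu4_shiftLen_add_one h h2
      have h7 : valF (v ++ [true]) = shiftLen mu4 w (valF v) + 1 := by
        rw [valF_append_singleton, h1]; rfl
      rw [h7]
      refine ⟨?_, by simpa using h6⟩
      have h8 := valF_append_true_false v
      rw [shiftLen_succ]
      omega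

theorem isPhiMorphism_mu4 : IsPhiMorphism mu4 := by
  intro w h n
  obtain ⟨hn, -, hc⟩ := isFibRep_repF n
  obtain ⟨h1, h2⟩ := shiftLen_valF h hc
  have h3 := h.apply_eq n
  rw [valF_append_singleton (repF n) true, ← h1, hn]
  rw [hn] at h2
  rw [h2] at h3
  split_ifs at h3 ⊢ <;> exact h3

/-- The automaton of `μ₄` reaches the letter of index `valF u` on the word `u`. -/
theorem foldlM_trans_mu4 {B : Type*} (ρ : Fin 18 → B) (h : IsFixedPoint mu4 w) {u : List Bool}
    (hu : NoConsecutiveOnes u) :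
    u.foldlM (morphismDFAO mu4 ρ (w 0)).trans (w 0) = some (w (valF u)) := by
  induction u using List.reverseRecOn with
  | nil => rfl
  | append_singleton v d ih =>
    obtain ⟨hv, hd⟩ := noConsecutiveOnes_append_singleton.1 hu
    obtain ⟨h1, h2⟩ := shiftLen_valF h hv
    have hlt : d.toNat < (mu4 (w (valF v))).length := by
      rw [h2]
      cases d
      · split_ifs <;> simp
      · rw [if_neg (hd rfl)]; simp
    have h3 := mu4_getElem? h hlt
    rw [h1, ← valF_append_singleton] at h3
    simp only [List.foldlM_append, ih hv, List.foldlM_cons, List.foldlM_nil]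
    simpa [morphismDFAO] using h3

theorem computes_morphismDFAO_mu4 {B : Type*} (ρ : Fin 18 → B) (h : IsFixedPoint mu4 w) :
    (morphismDFAO mu4 ρ (w 0)).Computes (fun n => ρ (w n)) := by
  intro n
  obtain ⟨hn, -, hc⟩ := isFibRep_repF n
  have := foldlM_trans_mu4 ρ h hc
  rw [hn] at this
  simp only [DFAO.output]
  rw [show (morphismDFAO mu4 ρ (w 0)).init = w 0 from rfl, this]
  rfl

end Representation

end WythoffK
namespace WythoffK

/-! ### Complementarity of the two coordinate sequences -/

section Complementary

/-- The factors of length four of `μ₄^ω(0)`, except its prefix. -/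
def factors4 : List (List (Fin 18)) := [
  [1, 2, 3, 4], [2, 3, 4, 5], [3, 4, 5, 6], [4, 5, 6, 7], [5, 6, 7, 8], [6, 7, 8, 9], [7, 8,
  9, 10], [7, 16, 14, 7], [7, 16, 14, 17], [8, 9, 10, 11], [9, 10, 11, 12], [10, 11, 12, 13],
  [11, 12, 13, 12], [11, 12, 13, 14], [11, 14, 15, 14], [11, 14, 17, 11], [12, 13, 12, 13],
  [12, 13, 14, 15], [12, 13, 14, 17], [13, 12, 13, 14], [13, 14, 15, 14], [13, 14, 17, 11],
  [14, 7, 16, 14], [14, 15, 14, 7], [14, 15, 14, 15], [14, 15, 14, 17], [14, 17, 11, 12],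
  [14, 17, 11, 14], [15, 14, 7, 16], [15, 14, 15, 14], [15, 14, 17, 11], [16, 14, 7, 16],
  [16, 14, 17, 11], [17, 11, 12, 13], [17, 11, 14, 15], [17, 11, 14, 17]]

/-- `factors4` contains the factors of length four of the images of its elements. -/
theorem factors4_closed : ∀ u ∈ factors4, ∀ i < 2,
    ((u.flatMap mu4).drop i).take 4 ∈ factors4 := by decide

theorem length_flatMap_factors4 : ∀ u ∈ factors4, 6 ≤ (u.flatMap mu4).length := by decide

/-- The consecutive differences of `shiftLen k + g₄(k)` are one or two. -/
theorem factors4_step : ∀ u ∈ factors4, ∀ c d, u[0]? = some c → u[1]? = some d →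
    (mu4 c).length + rho4 d = rho4 c + 1 ∨ (mu4 c).length + rho4 d = rho4 c + 2 := by decide

/-- For `u` at index `k`, the word `μ₄(u)` starts at index `s k`, so the gap is sought at `m = s k +
i`. As `s (s k) = s k + k`, the terms in `k` cancel from `seqB k = seqA m + 1`, leaving the first
equation; the second says that `seqA` steps by 2 at `m`. -/
theorem factors4_gap : ∀ u ∈ factors4, ∀ c, u[0]? = some c →
    ∃ i ≤ 3, ∃ x y, (u.flatMap mu4)[i]? = some x ∧ (u.flatMap mu4)[i + 1]? = some y ∧
      (((u.flatMap mu4).take i).flatMap mu4).length + rho4 x = 3 + rho4 c ∧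
      (mu4 x).length + rho4 y = rho4 x + 2 := by decide

/-- The infinite word `μ₄^ω(0)`. -/
def word4 : ℕ → Fin 18 := omegaPower mu4 0

theorem isFixedPoint_word4 : IsFixedPoint mu4 word4 :=
  isFixedPoint_omegaPower (t := [1]) rfl (by simp) mu4_ne_nil

theorem factor_word4_mem {k : ℕ} (hk : 0 < k) : factor word4 k 4 ∈ factors4 := by
  have h := isFixedPoint_word4
  induction k using Nat.strong_induction_on with
  | _ k ih =>
    obtain ⟨j, i, hj, hi, rfl⟩ := exists_lt_eq_shiftLen_add h hk
    rcases Nat.eq_zero_or_pos j with rfl | hj0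
    · have h1 := length_mu4_zero h
      -- Only `k = 1` comes from `μ₄(w 0)`; this first factor is computed directly.
      obtain rfl : i = 1 := by simp only [shiftLen_zero] at hk; omega
      decide
    · have h1 := ih j hj hj0
      have h2 := length_mu4 (word4 j)
      have h3 := factors4_closed _ h1 i (by omega)
      have h4 := length_flatMap_factors4 _ h1
      rw [h.flatMap_factor, drop_take_factor _ _ (by omega)] at h3
      exact h3

/-- `shiftLen k + 1 + g₄(k)`, for `k ≥ 1`: the smaller coordinates. -/
def seqA (k : ℕ) : ℕ := shiftLen mu4 word4 k + 1 + rho4 (word4 k)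

/-- The larger coordinates, for `k ≥ 1`. -/
def seqB (k : ℕ) : ℕ := seqA k + k + 4

theorem seqA_succ {k : ℕ} (hk : 0 < k) : seqA (k + 1) = seqA k + 1 ∨ seqA (k + 1) = seqA k + 2 := by
  have := factors4_step _ (factor_word4_mem hk) _ _ (getElem?_factor _ _ (by omega))
    (getElem?_factor _ _ (by omega))
  rw [seqA, seqA, shiftLen_succ]
  simp only [add_zero] at this
  omega

theorem seqB_succ {k : ℕ} (hk : 0 < k) : seqB (k + 1) = seqB k + 2 ∨ seqB (k + 1) = seqB k + 3 := by
  have := seqA_succ hk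
  simp only [seqB]
  omega

/-- Every `seqB k` lies in a gap of `seqA`. -/
theorem exists_seqA_gap {k : ℕ} (hk : 0 < k) :
    ∃ m, 0 < m ∧ seqB k = seqA m + 1 ∧ seqA (m + 1) = seqA m + 2 := by
  have h := isFixedPoint_word4
  have hmem := factor_word4_mem hk
  have hlen := length_flatMap_factors4 _ hmem
  obtain ⟨i, hi, x, y, hx, hy, h1, h2⟩ :=
    factors4_gap _ hmem _ (getElem?_factor _ _ (by omega))
  rw [h.flatMap_factor, getElem?_factor _ _ (by omega)] at hx hy
  rw [h.flatMap_factor, take_factor _ _ (by omega)] at h1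
  obtain rfl := Option.some.inj hx
  obtain rfl := Option.some.inj hy
  have h3 := shiftLen_add (μ := mu4) (w := word4) (shiftLen mu4 word4 k) i
  have h4 := shiftLen_mu4_shiftLen h k
  have h5 := lt_shiftLen_mu4 h hk
  refine ⟨shiftLen mu4 word4 k + i, by omega, ?_, ?_⟩
  · simp only [seqB, seqA, add_zero] at h1 ⊢
    omega
  · simp only [seqA, shiftLen_succ]
    simp only [← add_assoc] at h2
    omega

theorem strictMono_seqA_succ : StrictMono fun n => seqA (n + 1) :=
  strictMono_nat_of_lt_succ fun n => by
    have := seqA_succ n.succ_pos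
    simp only [Nat.succ_eq_add_one] at this
    omega

/-- `seqB l` lies strictly between two consecutive terms of `seqA`. -/
theorem seqA_ne_seqB {k l : ℕ} (hk : 0 < k) (hl : 0 < l) : seqA k ≠ seqB l := by
  obtain ⟨m, hm, h1, h2⟩ := exists_seqA_gap hl
  obtain ⟨k, rfl⟩ := Nat.exists_eq_add_of_lt hk
  obtain ⟨m, rfl⟩ := Nat.exists_eq_add_of_lt hm
  simp only [zero_add] at *
  rcases lt_or_ge m k with h | h
  · have : seqA (m + 1 + 1) ≤ seqA (k + 1) := strictMono_seqA_succ.monotone h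
    omega
  · have : seqA (k + 1) ≤ seqA (m + 1) := strictMono_seqA_succ.monotone h
    omega

theorem exists_eq_seqA_or_seqB {x : ℕ} (hx : 5 ≤ x) :
    ∃ n, x = seqA (n + 1) ∨ x = seqB (n + 1) := by
  have h0 : ∀ i < 5, seqA (i + 1) = i + 5 := by decide
  have hB : seqB 1 = 10 := by decide
  rcases lt_or_ge x 10 with h | h
  · exact ⟨x - 5, Or.inl (by rw [h0 _ (by omega)]; omega)⟩
  -- Locate `x` between two consecutive terms of `seqB`.
  have key : ∃ n, seqB (n + 1) ≤ x ∧ x < seqB (n + 1 + 1) := by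
    clear h0
    induction x, h using Nat.le_induction with
    | base =>
      have := seqB_succ one_pos
      exact ⟨0, hB.le, by rw [zero_add]; omega⟩
    | succ x hx' ih =>
      obtain ⟨n, h1, h2⟩ := ih (by omega)
      rcases Nat.lt_or_ge (x + 1) (seqB (n + 1 + 1)) with h3 | h3
      · exact ⟨n, by omega, h3⟩
      · have := seqB_succ (k := n + 1 + 1) (by omega)
        exact ⟨n + 1, h3, by omega⟩
  obtain ⟨n, h1, h2⟩ := key
  obtain ⟨m, -, h3, h4⟩ := exists_seqA_gap (k := n + 1) (by omega)
  obtain ⟨l, hl, h5, -⟩ := exists_seqA_gap (k := n + 1 + 1) (by omega)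
  have h7 := seqB_succ (k := n + 1) (by omega)
  obtain ⟨l, rfl⟩ := Nat.exists_eq_add_of_lt hl
  rcases eq_or_ne x (seqB (n + 1)) with rfl | hne
  · exact ⟨n, Or.inr rfl⟩
  -- Steps of at most 3 leave two cases: `x` just after `seqB (n + 1)`, the upper end of its gap, or
  -- just before the next term, the lower end of the gap there.
  · by_cases h9 : x = seqB (n + 1) + 1
    · exact ⟨m, Or.inl (by omega)⟩
    · refine ⟨l, Or.inl ?_⟩
      rw [zero_add] at h5
      omega

theorem posA_eq (n : ℕ) : posA n = seqA (n + 1) := by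
  have := floor_mul_goldenRatio isFixedPoint_word4 (n + 1)
  rw [Nat.cast_add, Nat.cast_one, add_assoc, one_add_one_eq_two] at this
  rw [posA, this]; rfl

theorem posB_eq (n : ℕ) : posB n = posA n + n + 5 := by
  have h : ((n : ℝ) + 2) * Real.goldenRatio ^ 2 =
      ((n : ℝ) + 2) * Real.goldenRatio + (n + 2 : ℕ) := by
    rw [Real.goldenRatio_sq]; push_cast; ring
  rw [posB, posA, h, Nat.floor_add_natCast (by have := Real.goldenRatio_pos; positivity)]
  omega

theorem posB_eq_seqB (n : ℕ) : posB n = seqB (n + 1) := by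
  rw [posB_eq, posA_eq, seqB]; omega

end Complementary

end WythoffK

/-- The `P`-positions `(a, b)`, `a ≤ b`, of the game `K⁴`. -/
theorem mainTheorem7 :
    -- the `φ`-morphism, its fixed point, and the Fibonacci-automatic sequence `g₄`
    WythoffK.IsPhiMorphism WythoffK.mu4 ∧
    WythoffK.IsOmegaLimit WythoffK.mu4 0 (WythoffK.omegaPower WythoffK.mu4 0) ∧
    WythoffK.IsFixedPoint WythoffK.mu4 (WythoffK.omegaPower WythoffK.mu4 0) ∧
    (WythoffK.morphismDFAO WythoffK.mu4 WythoffK.rho4 0).Computes WythoffK.g4 ∧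
    WythoffK.IsFibonacciAutomatic WythoffK.g4 ∧
    -- the `P`-positions with `a ≤ b`
    (∀ a b : ℕ, a ≤ b →
      (WythoffK.IsPPosition 4 (a, b) ↔
        WythoffK.IsTerminal 4 (a, b) ∨
          ∃ n : ℕ, a = WythoffK.posA n ∧ b = WythoffK.posB n)) ∧
    -- the pairs `(a_n, b_n)` are non-terminal, with `a_n < b_n`, and listed in increasing order
    (∀ n : ℕ, ¬ WythoffK.IsTerminal 4 (WythoffK.posA n, WythoffK.posB n)) ∧
    (∀ n : ℕ, WythoffK.posA n < WythoffK.posB n) ∧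
    StrictMono WythoffK.posA ∧ StrictMono WythoffK.posB := by
  have hμ : WythoffK.mu4 0 = 0 :: [1] := rfl
  have hfix := WythoffK.isFixedPoint_word4
  have hcomp := WythoffK.computes_morphismDFAO_mu4 WythoffK.rho4 hfix
  have hB := WythoffK.posB_eq
  have hA : StrictMono WythoffK.posA := by
    rw [funext WythoffK.posA_eq]
    exact WythoffK.strictMono_seqA_succ
  have h0 : WythoffK.posA 0 = 5 := by
    rw [WythoffK.posA_eq]
    decide
  refine ⟨WythoffK.isPhiMorphism_mu4,
    WythoffK.isOmegaLimit_omegaPower hμ (by simp) WythoffK.mu4_ne_nil, hfix, hcomp,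
    ⟨18, _, hcomp⟩, fun a b hab => WythoffK.isPPosition_four_iff hA hB h0.ge ?_ ?_ hab,
    fun n => ?_, fun n => ?_, hA, fun i j hij => ?_⟩
  · intro n m
    rw [WythoffK.posA_eq, WythoffK.posB_eq_seqB]
    exact WythoffK.seqA_ne_seqB n.succ_pos m.succ_pos
  · intro x hx
    simp only [WythoffK.posA_eq, WythoffK.posB_eq_seqB]
    exact WythoffK.exists_eq_seqA_or_seqB hx
  · have := hB n
    simp only [WythoffK.IsTerminal]
    omega
  · have := hB n
    omega
  · have := hA hij
    rw [hB, hB]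
    omega
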